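/- Let $E$ be a separable real Banach space with norm $|\cdot|$, and let $\mathrm{UC}_b$ be the set of bounded uniformly continuous functions $E\to\mathbb R$. Let $c\colon E\to[0,\infty]$ be convex with $c(0)=0$ and $c(a)/|a|\to\infty$ as $|a|\to\infty$, and put $$\overline c(b):=\sup_{a\in E}\big(b|a|-c(a)\big),\qquad b\in[0,\infty).$$ Let $(Y_t)_{t\ge0}$ be an $E$-valued Lévy process on a filtered probability space $(\Omega,\mathcal F,(\mathcal F_t)_{t\ge0},\mathbb P)$: it is adapted, $Y_0=0$ almost surely, $Y_t-Y_s$ is independent of $\mathcal F_s$ for $s\le t$, the increments are stationary, and $Y$ is continuous in probability. No completeness or right-continuity of the filtration is assumed. Let $\mu_t$ be the law of $Y_t$ for $t>0$. For $f\in\mathrm{UC}_b$, $t>0$ and $x\in E$ define $$(\Phi_tf)(x):=\sup_{a\in E}\big(f(x+a)-t\,c(a/t)\big),\qquad (\mu_tf)(x):=\int_Ef(x+y)\,\mu_t(dy),$$ $$I_tf:=\mu_t\Phi_tf,\qquad J_tf:=\Phi_t\mu_tf,$$ and $I_0f:=J_0f:=f$. Let $\mathcal A$ be the set of all (jointly measurable)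 adapted processes $\alpha\colon[0,\infty)\times\Omega\to E$ with $\int_0^t|\alpha_u|\,du<\infty$ almost surely for all $t\ge0$, and define $$(V_tf)(x):=\sup_{\alpha\in\mathcal A}\mathbb E\Big[f\Big(x+Y_t+\int_0^t\alpha_u\,du\Big)-\int_0^tc(\alpha_u)\,du\Big].$$ For $f\in\mathrm{UC}_b$ and $\varepsilon>0$ put $\operatorname{var}f:=\sup_{x,y\in E}|f(x)-f(y)|$ and $$\omega_f^{-1}(\varepsilon):=\sup\{\delta>0:\ |f(x)-f(y)|\le\varepsilon\text{ for all }x,y\in E\text{ with }|x-y|\le\delta\}\in(0,\infty],$$ where $\operatorname{var}f/\infty:=0$, and put $\|f\|_{\mathrm{Lip}}:=\sup_{x,y\in E}\frac{|f(x)-f(y)|}{|x-y|}$ with $\frac00:=0$. Let $\|\cdot\|_\infty$ be the supremum norm. Then, for every $t\ge0$ and $f\in\mathrm{UC}_b$, the following holds, where $n$ ranges over $\{1,2,\dots\}$ and inequalities, suprema and infima of functions are pointwise on $E$. (a) For all $n$, $$J_{t/n}^nf\le V_tf\le I_{t/n}^nf,$$ and, for all $\varepsilon>0$, $$\big\|I_{t/n}^nf-J_{t/n}^nf\big\|_\infty\le\varepsilon\quad\text{if}\quad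 n\ge\frac t\varepsilon\,\overline c\Big(\frac{\operatorname{var}f}{\omega_f^{-1}(\varepsilon)}\Big).$$ Moreover, $$\sup_{n}J_{t/n}^nf=V_tf=\inf_{n}I_{t/n}^nf.$$ (b) If $\|f\|_{\mathrm{Lip}}<\infty$, then, for all $n$, $$\big\|I_{t/n}^nf-J_{t/n}^nf\big\|_\infty\le\frac tn\,\overline c\big(\|f\|_{\mathrm{Lip}}\big).$$ -/

import Mathlib

open MeasureTheory ProbabilityTheory Filter Topology
open scoped NNReal ENNReal

namespace LevyControl

noncomputable section

/-- Bounded and uniformly continuous real-valued functions on `E`. -/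
def IsUCb {E : Type*} [NormedAddCommGroup E] (f : E → ℝ) : Prop :=
  UniformContinuous f ∧ ∃ C : ℝ, ∀ x, |f x| ≤ C

/-- The oscillation `var f = sup_{x, y} |f x - f y|`. -/
def oscillation {E : Type*} [NormedAddCommGroup E] (f : E → ℝ) : ℝ≥0∞ :=
  ⨆ (x : E) (y : E), ‖f x - f y‖ₑ

/-- The inverse modulus of continuity `ω_f⁻¹(ε)`, a value in `[0, ∞]`. -/
def invModulus {E : Type*} [NormedAddCommGroup E] (f : E → ℝ) (ε : ℝ) : ℝ≥0∞ :=
  sSup {d : ℝ≥0∞ | ∃ δ : ℝ, 0 < δ ∧ (∀ x y : E, ‖x - y‖ ≤ δ → |f x - f y| ≤ ε) ∧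
    d = ENNReal.ofReal δ}

/-- The Lipschitz seminorm `sup_{x, y} |f x - f y| / ‖x - y‖` with `0 / 0 = 0`,
a value in `[0, ∞]`. -/
def lipSeminorm {E : Type*} [NormedAddCommGroup E] (f : E → ℝ) : ℝ≥0∞ :=
  ⨆ (x : E) (y : E), ‖f x - f y‖ₑ / ‖x - y‖ₑ

/-- A running cost: a convex function `c : E → [0, ∞]` with `c 0 = 0` and
`c a / ‖a‖ → ∞` as `‖a‖ → ∞`. -/
structure IsCost {E : Type*} [NormedAddCommGroup E] [NormedSpace ℝ E] (c : E → ℝ≥0∞) :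
    Prop where
  convex : ConvexOn ℝ≥0 Set.univ c
  zero : c 0 = 0
  superlinear : Tendsto (fun a => c a / ‖a‖ₑ) (Bornology.cobounded E) (𝓝 ⊤)

/-- The function `c̄(b) = sup_a (b ‖a‖ - c a)`. -/
def conj {E : Type*} [NormedAddCommGroup E] (c : E → ℝ≥0∞) (b : ℝ) : EReal :=
  ⨆ a : E, (((b * ‖a‖ : ℝ) : EReal) - (c a : EReal))

/-- The Hopf-Lax operator `(Φ_t f)(x) = sup_a (f (x + a) - t c(a / t))` for `t > 0`, and
`Φ_0 f = f`. For bounded `f` and `c 0 = 0` the supremum is finite, so that `toReal` only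
changes its type. -/
def hopfLax {E : Type*} [NormedAddCommGroup E] [NormedSpace ℝ E] (c : E → ℝ≥0∞) (t : ℝ≥0)
    (f : E → ℝ) (x : E) : ℝ :=
  if t = 0 then f x
  else (⨆ a : E, ((f (x + a) : EReal) - (((t : ℝ≥0∞) * c (t⁻¹ • a) : ℝ≥0∞) : EReal))).toReal

/-- `(μ f)(x) = ∫ f (x + y) μ(dy)`. -/
def transition {E : Type*} [NormedAddCommGroup E] [MeasurableSpace E] (μ : Measure E)
    (f : E → ℝ) (x : E) : ℝ :=
  ∫ y, f (x + y) ∂μ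

/-- `I_t f = μ_t Φ_t f` for `t > 0`, and `I_0 f = f`. -/
def opI {E : Type*} [NormedAddCommGroup E] [NormedSpace ℝ E] [MeasurableSpace E]
    (c : E → ℝ≥0∞) (μ : ℝ≥0 → Measure E) (t : ℝ≥0) (f : E → ℝ) : E → ℝ :=
  if t = 0 then f else transition (μ t) (hopfLax c t f)

/-- `J_t f = Φ_t μ_t f` for `t > 0`, and `J_0 f = f`. -/
def opJ {E : Type*} [NormedAddCommGroup E] [NormedSpace ℝ E] [MeasurableSpace E]
    (c : E → ℝ≥0∞) (μ : ℝ≥0 → Measure E) (t : ℝ≥0) (f : E → ℝ) : E → ℝ :=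
  if t = 0 then f else hopfLax c t (transition (μ t) f)

/-- Lévy processes with respect to a filtration: adapted, started at `0`, with increments that
are stationary and independent of the past, and continuous in probability. -/
structure IsLevyProcess {E Ω : Type*} [NormedAddCommGroup E] [MeasurableSpace E]
    [BorelSpace E] {mΩ : MeasurableSpace Ω} (P : Measure Ω) (ℱ : Filtration ℝ≥0 mΩ)
    (Y : ℝ≥0 → Ω → E) : Prop where
  adapted : Adapted ℱ Y
  zero : ∀ᵐ ω ∂P, Y 0 ω = 0
  indep : ∀ s t : ℝ≥0, s ≤ t →
    Indep (MeasurableSpace.comap (fun ω => Y t ω - Y s ω) inferInstance) (ℱ s) P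
  stationary : ∀ s t : ℝ≥0, IdentDistrib (fun ω => Y (s + t) ω - Y s ω) (Y t) P P
  continuous_in_probability : ∀ t : ℝ≥0, TendstoInMeasure P Y (𝓝 t) (Y t)

/-- Admissible controls: (jointly measurable) adapted processes `α : [0, ∞) × Ω → E` such that
`∫_0^t ‖α_u‖ du < ∞` almost surely for all `t ≥ 0`. -/
structure IsControl {E Ω : Type*} [NormedAddCommGroup E] [MeasurableSpace E]
    {mΩ : MeasurableSpace Ω} (P : Measure Ω) (ℱ : Filtration ℝ≥0 mΩ)
    (α : ℝ≥0 → Ω → E) : Prop where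
  measurable : Measurable (Function.uncurry α)
  adapted : Adapted ℱ α
  integrable : ∀ᵐ ω ∂P, ∀ t : ℝ≥0, ∫⁻ u in Set.Ioc (0 : ℝ) t, ‖α u.toNNReal ω‖ₑ < ⊤

/-- The controlled state `x + Y_t + ∫_0^t α_u du`. -/
def controlled {E Ω : Type*} [NormedAddCommGroup E] [NormedSpace ℝ E]
    (Y α : ℝ≥0 → Ω → E) (x : E) (t : ℝ≥0) (ω : Ω) : E :=
  x + Y t ω + ∫ u in Set.Ioc (0 : ℝ) t, α u.toNNReal ω

/-- The running cost `∫_0^t c(α_u) du`. -/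
def runningCost {E Ω : Type*} (c : E → ℝ≥0∞) (α : ℝ≥0 → Ω → E) (t : ℝ≥0) (ω : Ω) : ℝ≥0∞ :=
  ∫⁻ u in Set.Ioc (0 : ℝ) t, c (α u.toNNReal ω)

/-- The value function
`(V_t f)(x) = sup_α E[f (x + Y_t + ∫_0^t α_u du) - ∫_0^t c(α_u) du]`, where the supremum is over
the admissible controls. As `f` is bounded and `c` is nonnegative, the expectation of the
difference is the difference of the expectations, with a value in `[-∞, ∞)`. -/
def value {E Ω : Type*} [NormedAddCommGroup E] [NormedSpace ℝ E] [MeasurableSpace E]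
    {mΩ : MeasurableSpace Ω} (P : Measure Ω) (ℱ : Filtration ℝ≥0 mΩ) (Y : ℝ≥0 → Ω → E)
    (c : E → ℝ≥0∞) (t : ℝ≥0) (f : E → ℝ) (x : E) : EReal :=
  ⨆ (α : ℝ≥0 → Ω → E) (_ : IsControl P ℱ α),
    (((∫ ω, f (controlled Y α x t ω) ∂P : ℝ) : EReal) -
      ((∫⁻ ω, runningCost c α t ω ∂P : ℝ≥0∞) : EReal))

end

end LevyControl

/-!
The operators `Φ_h` and `μ_h` are monotone, translation invariant and compatible with adding
constants. Re-bracketing `(μ_h Φ_h)ⁿ = μ_h (Φ_h μ_h)ⁿ⁻¹ Φ_h` therefore shows that `I_h^n f` and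
`J_h^n f` differ by what a single `Φ_h` adds to `f`, which is at most `max ε (h c̄(b))` when
`f (x + a) - f x ≤ max ε (b ‖a‖)`, by the Fenchel inequality `b ‖a‖ ≤ c a + c̄(b)`.

The value function lies between `J_h^n f` and `I_h^n f` by dynamic programming, in the form
`V_s (J_h g) ≤ V_{s+h} g ≤ V_s (I_h g)`. On the left, a nearly optimal displacement is chosen
measurably from the state at time `s` and followed at constant speed during `(s, s + h]`. On the
right, Jensen's inequality says that no control on `(s, s + h]` does better than a constant
velocity chosen with foresight of the increment of `Y`. Since `c` need not be measurable, Jensen's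
inequality is applied to its lower semicontinuous envelope.
-/

namespace LevyControl

theorem coe_sub_coe_ennreal_le_coe_iff {a b : ℝ} {k : ℝ≥0∞} :
    (a : EReal) - (k : EReal) ≤ (b : EReal) ↔ ENNReal.ofReal (a - b) ≤ k := by
  induction k with
  | top => simp
  | coe k =>
    change ((a - k : ℝ) : EReal) ≤ b ↔ _
    rw [EReal.coe_le_coe_iff, ENNReal.ofReal_le_iff_le_toReal ENNReal.coe_ne_top,
      ENNReal.coe_toReal, sub_le_comm]

section ShiftMonotone

variable {E : Type*} [NormedAddCommGroup E] {f g : E → ℝ} {S T M Φ : (E → ℝ) → E → ℝ} {r : ℝ}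

theorem IsUCb.bddAbove_range (hf : IsUCb f) : BddAbove (Set.range f) := by
  obtain ⟨C, hC⟩ := hf.2
  exact ⟨C, Set.forall_mem_range.2 fun x => (abs_le.1 (hC x)).2⟩

theorem isUCb_const (C : ℝ) : IsUCb fun _ : E => C :=
  ⟨uniformContinuous_const, |C|, fun _ => le_rfl⟩

/-- Monotonicity, translation invariance and `T (g + r) ≤ T g + r` of an operator `T` on bounded
uniformly continuous functions, expressed by a single inequality. These are the properties of
`hopfLax` and `transition` from which the splitting error is estimated. -/
def IsShiftMonotone (T : (E → ℝ) → E → ℝ) : Prop :=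
  ∀ ⦃f g : E → ℝ⦄, IsUCb f → IsUCb g → ∀ ⦃x y : E⦄ ⦃r : ℝ⦄,
    (∀ z, f (x + z) ≤ g (y + z) + r) → T f x ≤ T g y + r

namespace IsShiftMonotone

theorem isUCb (hT : IsShiftMonotone T) (hf : IsUCb f) : IsUCb (T f) := by
  refine ⟨Metric.uniformContinuous_iff_le.2 fun ε hε => ?_, ?_⟩
  · obtain ⟨δ, hδ, hfδ⟩ := Metric.uniformContinuous_iff_le.1 hf.1 ε hε
    have hle : ∀ x y, dist x y ≤ δ → T f x ≤ T f y + ε := fun x y hxy =>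
      hT hf hf fun z => by
        have := hfδ (a := x + z) (b := y + z) (by rwa [dist_add_right])
        rw [Real.dist_eq] at this
        linarith [le_abs_self (f (x + z) - f (y + z))]
    refine ⟨δ, hδ, fun {x y} hxy => ?_⟩
    rw [Real.dist_eq, abs_sub_le_iff, sub_le_iff_le_add', sub_le_iff_le_add']
    exact ⟨hle x y hxy, hle y x (by rwa [dist_comm])⟩
  · obtain ⟨C, hC⟩ := hf.2
    refine ⟨|T (fun _ => 0) 0| + C, fun x => ?_⟩
    have hupper : T f x ≤ T (fun _ => 0) 0 + C :=
      hT hf (isUCb_const 0) fun z => by simpa using (abs_le.1 (hC (x + z))).2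
    have hlower : T (fun _ => 0) 0 ≤ T f x + C :=
      hT (isUCb_const 0) hf fun z => by linarith [(abs_le.1 (hC (x + z))).1]
    rw [abs_le]
    constructor <;> linarith [abs_le.1 (le_refl |T (fun _ => 0) (0 : E)|)]

theorem comp (hS : IsShiftMonotone S) (hT : IsShiftMonotone T) : IsShiftMonotone (S ∘ T) :=
  fun _ _ hf hg _ _ _ h => hS (hT.isUCb hf) (hT.isUCb hg) fun z =>
    hT hf hg fun w => by simpa only [add_assoc] using h (z + w)

theorem iterate (hT : IsShiftMonotone T) (n : ℕ) : IsShiftMonotone T^[n] := by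
  induction n with
  | zero => exact fun f g _ _ x y r h => by simpa using h 0
  | succ n ih => exact ih.comp hT

/-- Re-bracketing `(M Φ)ⁿ = M (Φ M)ⁿ⁻¹ Φ` leaves a single application of `Φ` to account for. -/
theorem iterate_comp_le_iterate_comp_add (hM : IsShiftMonotone M) (hΦ : IsShiftMonotone Φ)
    (hself : ∀ g, IsUCb g → ∀ x, g x ≤ Φ g x) (hf : IsUCb f) (h : ∀ x, Φ f x ≤ f x + r) {n : ℕ}
    (hn : 1 ≤ n) (x : E) : (M ∘ Φ)^[n] f x ≤ (Φ ∘ M)^[n] f x + r := by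
  obtain ⟨n, rfl⟩ := Nat.exists_eq_add_of_le' hn
  have hrebracket : Function.Semiconj M (Φ ∘ M) (M ∘ Φ) := fun _ => rfl
  have hT : IsShiftMonotone (M ∘ (Φ ∘ M)^[n]) := hM.comp ((hΦ.comp hM).iterate n)
  calc (M ∘ Φ)^[n + 1] f x = (M ∘ (Φ ∘ M)^[n]) (Φ f) x :=
        congrFun ((hrebracket.iterate_right n).eq (Φ f)).symm x
    _ ≤ (M ∘ (Φ ∘ M)^[n]) f x + r := hT (hΦ.isUCb hf) hf fun z => h (x + z)
    _ ≤ Φ ((M ∘ (Φ ∘ M)^[n]) f) x + r := by gcongr; exact hself _ (hT.isUCb hf) x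
    _ = (Φ ∘ M)^[n + 1] f x + r := by rw [Function.iterate_succ_apply']; rfl

end IsShiftMonotone

end ShiftMonotone

section HopfLax

variable {E : Type*} [NormedAddCommGroup E] [NormedSpace ℝ E] {c : E → ℝ≥0∞} {t : ℝ≥0}
  {f : E → ℝ} {x : E} {r : ℝ}

theorem hopfLax_zero : hopfLax c 0 = id := by
  funext f x
  simp [hopfLax]

theorem coe_hopfLax (h0 : c 0 = 0) (hf : BddAbove (Set.range f)) (ht : t ≠ 0) (x : E) :
    (hopfLax c t f x : EReal) =
      ⨆ a : E, ((f (x + a) : EReal) - (((t : ℝ≥0∞) * c (t⁻¹ • a) : ℝ≥0∞) : EReal)) := by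
  obtain ⟨C, hC⟩ := hf
  rw [hopfLax, if_neg ht, EReal.coe_toReal]
  · refine ne_top_of_le_ne_top (EReal.coe_ne_top C) (iSup_le fun a => ?_)
    rw [coe_sub_coe_ennreal_le_coe_iff,
      ENNReal.ofReal_of_nonpos (sub_nonpos.2 (hC (Set.mem_range_self _)))]
    exact zero_le
  · exact ne_bot_of_le_ne_bot (EReal.coe_ne_bot (f x)) (le_iSup_of_le 0 (by simp [h0]))

theorem hopfLax_le_iff (h0 : c 0 = 0) (hf : BddAbove (Set.range f)) :
    hopfLax c t f x ≤ r ↔ ∀ b, ENNReal.ofReal (f (x + t • b) - r) ≤ t * c b := by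
  rcases eq_or_ne t 0 with rfl | ht
  · simp [hopfLax_zero]
  · rw [← EReal.coe_le_coe_iff, coe_hopfLax h0 hf ht, iSup_le_iff,
      (MulAction.bijective₀ ht).surjective.forall]
    simp only [coe_sub_coe_ennreal_le_coe_iff, inv_smul_smul₀ ht]

theorem lt_hopfLax_iff (h0 : c 0 = 0) (hf : BddAbove (Set.range f)) :
    r < hopfLax c t f x ↔ ∃ b, t * c b < ENNReal.ofReal (f (x + t • b) - r) := by
  simpa using (hopfLax_le_iff h0 hf).not

theorem ofReal_sub_hopfLax_le (h0 : c 0 = 0) (hf : BddAbove (Set.range f)) (b : E) :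
    ENNReal.ofReal (f (x + t • b) - hopfLax c t f x) ≤ t * c b :=
  (hopfLax_le_iff h0 hf).1 le_rfl b

theorem self_le_hopfLax (h0 : c 0 = 0) (hf : BddAbove (Set.range f)) (x : E) :
    f x ≤ hopfLax c t f x := by
  simpa [h0] using ofReal_sub_hopfLax_le (t := t) (x := x) h0 hf 0

theorem isShiftMonotone_hopfLax (h0 : c 0 = 0) : IsShiftMonotone (hopfLax c t) :=
  fun f g hf hg x y r h => by
    rw [hopfLax_le_iff h0 hf.bddAbove_range]
    exact fun b => (ENNReal.ofReal_le_ofReal (by linarith [h (t • b)])).trans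
      (ofReal_sub_hopfLax_le h0 hg.bddAbove_range b)

end HopfLax

section Transition

variable {E : Type*} [NormedAddCommGroup E] [MeasurableSpace E] {f g : E → ℝ}

theorem transition_dirac_zero [MeasurableSingletonClass E] :
    transition (Measure.dirac (0 : E)) = id := by
  funext f x
  simp [transition]

variable [BorelSpace E]

theorem IsUCb.integrable_comp {Ω : Type*} {mΩ : MeasurableSpace Ω} {P : Measure Ω}
    [IsFiniteMeasure P] (hf : IsUCb f) {X : Ω → E} (hX : AEMeasurable X P) :
    Integrable (fun ω => f (X ω)) P := by
  obtain ⟨C, hC⟩ := hf.2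
  exact .of_bound (hf.1.continuous.measurable.comp_aemeasurable hX).aestronglyMeasurable C
    (Eventually.of_forall fun ω => hC _)

theorem isShiftMonotone_transition (ν : Measure E) [IsProbabilityMeasure ν] :
    IsShiftMonotone (transition ν) := fun f g hf hg x y r h => by
  have hint : ∀ {k : E → ℝ} (w : E), IsUCb k → Integrable (fun z => k (w + z)) ν :=
    fun w hk => hk.integrable_comp (measurable_const_add w).aemeasurable
  calc transition ν f x ≤ ∫ z, (g (y + z) + r) ∂ν :=
        integral_mono (hint x hf) ((hint y hg).add (integrable_const r)) h
    _ = transition ν g y + r := by simp [integral_add (hint y hg), transition]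

end Transition

section Modulus

variable {E : Type*} [NormedAddCommGroup E] {f : E → ℝ} {ε : ℝ}

theorem sub_le_lipSeminorm_mul (hf : lipSeminorm f ≠ ⊤) (x a : E) :
    f (x + a) - f x ≤ (lipSeminorm f).toReal * ‖a‖ := by
  rcases eq_or_ne a 0 with rfl | ha
  · simp
  have hquot : ‖f (x + a) - f x‖ₑ / ‖x + a - x‖ₑ ≤ lipSeminorm f :=
    le_iSup₂ (f := fun x y : E => ‖f x - f y‖ₑ / ‖x - y‖ₑ) (x + a) x
  rw [add_sub_cancel_left, ENNReal.div_le_iff (by simpa using ha) enorm_ne_top] at hquot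
  have hreal := ENNReal.toReal_mono (ENNReal.mul_ne_top hf enorm_ne_top) hquot
  rw [ENNReal.toReal_mul, toReal_enorm, toReal_enorm] at hreal
  exact (le_abs_self _).trans hreal

theorem invModulus_ne_zero (hf : UniformContinuous f) (hε : 0 < ε) : invModulus f ε ≠ 0 := by
  obtain ⟨δ, hδ, hfδ⟩ := Metric.uniformContinuous_iff_le.1 hf ε hε
  have hle : ENNReal.ofReal δ ≤ invModulus f ε :=
    le_sSup ⟨δ, hδ, fun x y hxy => hfδ (by rwa [dist_eq_norm]), rfl⟩
  exact ((ENNReal.ofReal_pos.2 hδ).trans_le hle).ne'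

theorem oscillation_ne_top (hf : ∃ C : ℝ, ∀ x, |f x| ≤ C) : oscillation f ≠ ⊤ := by
  obtain ⟨C, hC⟩ := hf
  refine ne_top_of_le_ne_top (ENNReal.ofReal_ne_top (r := C + C)) (iSup₂_le fun x y => ?_)
  rw [← ofReal_norm]
  exact ENNReal.ofReal_le_ofReal ((norm_sub_le _ _).trans (add_le_add (hC x) (hC y)))

theorem abs_sub_le_of_ofReal_lt_invModulus {x y : E}
    (h : ENNReal.ofReal ‖x - y‖ < invModulus f ε) : |f x - f y| ≤ ε := by
  obtain ⟨_, ⟨δ, hδ, hfδ, rfl⟩, hlt⟩ := lt_sSup_iff.1 h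
  exact hfδ x y ((ENNReal.ofReal_lt_ofReal_iff hδ).1 hlt).le

theorem IsUCb.sub_le_max (hf : IsUCb f) (hε : 0 < ε) (x a : E) :
    f (x + a) - f x ≤ max ε ((oscillation f / invModulus f ε).toReal * ‖a‖) := by
  rcases lt_or_ge (ENNReal.ofReal ‖a‖) (invModulus f ε) with hclose | hfar
  · have hε : |f (x + a) - f x| ≤ ε :=
      abs_sub_le_of_ofReal_lt_invModulus (by rwa [add_sub_cancel_left])
    exact (le_abs_self _).trans (hε.trans (le_max_left _ _))
  · have hm0 := invModulus_ne_zero hf.1 hε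
    have hosc : ‖f (x + a) - f x‖ₑ ≤ oscillation f / invModulus f ε * ENNReal.ofReal ‖a‖ :=
      calc ‖f (x + a) - f x‖ₑ ≤ oscillation f :=
            le_iSup₂ (f := fun x y : E => ‖f x - f y‖ₑ) (x + a) x
        _ = oscillation f / invModulus f ε * invModulus f ε :=
            (ENNReal.div_mul_cancel hm0 (ne_top_of_le_ne_top ENNReal.ofReal_ne_top hfar)).symm
        _ ≤ oscillation f / invModulus f ε * ENNReal.ofReal ‖a‖ := by gcongr
    have hreal := ENNReal.toReal_mono (ENNReal.mul_ne_top
      (ENNReal.div_ne_top (oscillation_ne_top hf.2) hm0) ENNReal.ofReal_ne_top) hosc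
    rw [ENNReal.toReal_mul, toReal_enorm, ENNReal.toReal_ofReal (norm_nonneg _)] at hreal
    exact (le_abs_self _).trans (hreal.trans (le_max_right _ _))

end Modulus

section Conjugate

variable {E : Type*} [NormedAddCommGroup E] {c : E → ℝ≥0∞} {b K : ℝ}

theorem conj_le_iff : conj c b ≤ K ↔ ∀ a, ENNReal.ofReal (b * ‖a‖ - K) ≤ c a := by
  simp only [conj, iSup_le_iff, coe_sub_coe_ennreal_le_coe_iff]

theorem conj_nonneg (h0 : c 0 = 0) (b : ℝ) : 0 ≤ conj c b :=
  le_iSup_of_le 0 (by simp [h0])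

theorem conj_ne_bot (h0 : c 0 = 0) (b : ℝ) : conj c b ≠ ⊥ :=
  (EReal.bot_lt_zero.trans_le (conj_nonneg h0 b)).ne'

theorem exists_nat_mul_conj_le (h0 : c 0 = 0) (hfin : conj c b ≠ ⊤) (r : ℝ) :
    ∃ n : ℕ, 1 ≤ n ∧ (r : EReal) * conj c b ≤ (n : ℝ) := by
  lift conj c b to ℝ using ⟨hfin, conj_ne_bot h0 b⟩ with K
  obtain ⟨n, hn⟩ := exists_nat_ge (r * K)
  refine ⟨n + 1, n.succ_pos, EReal.coe_mul r K ▸ EReal.coe_le_coe_iff.2 (hn.trans ?_)⟩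
  exact Nat.cast_le.2 n.le_succ

theorem conj_ne_top (hc : Tendsto (fun a => c a / ‖a‖ₑ) (Bornology.cobounded E) (𝓝 ⊤)) (b : ℝ) :
    conj c b ≠ ⊤ := by
  obtain ⟨R, hR⟩ := (hasBasis_cobounded_norm (E := E)).eventually_iff.1
    (hc.eventually (lt_mem_nhds (ENNReal.ofReal_lt_top (r := |b|))))
  refine ne_top_of_le_ne_top (EReal.coe_ne_top (|b| * max R 0)) (conj_le_iff.2 fun a => ?_)
  have hb : b * ‖a‖ ≤ |b| * ‖a‖ := by gcongr; exact le_abs_self b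
  have hR0 : 0 ≤ |b| * max R 0 := by positivity
  rcases le_total (max R 0) ‖a‖ with hfar | hnear
  · calc ENNReal.ofReal (b * ‖a‖ - |b| * max R 0) ≤ ENNReal.ofReal (|b| * ‖a‖) :=
          ENNReal.ofReal_le_ofReal (by linarith)
      _ = ENNReal.ofReal |b| * ‖a‖ₑ := by rw [ENNReal.ofReal_mul (abs_nonneg b), ofReal_norm]
      _ ≤ c a := ENNReal.mul_le_of_le_div (hR.2 ((le_max_left R 0).trans hfar)).le
  · have hle : |b| * ‖a‖ ≤ |b| * max R 0 := by gcongr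
    rw [ENNReal.ofReal_of_nonpos (by linarith)]
    exact zero_le

variable [NormedSpace ℝ E] {t : ℝ≥0} {f : E → ℝ} {x : E} {ε : ℝ}

theorem hopfLax_le_add_max (h0 : c 0 = 0) (hf : BddAbove (Set.range f)) (hK : conj c b ≤ K)
    (h : ∀ a, f (x + a) - f x ≤ max ε (b * ‖a‖)) : hopfLax c t f x ≤ f x + max ε (t * K) := by
  refine (hopfLax_le_iff h0 hf).2 fun a => ?_
  have hnorm : b * ‖t • a‖ = t * (b * ‖a‖) := by
    rw [NNReal.smul_def, norm_smul, Real.norm_of_nonneg t.coe_nonneg]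
    ring
  rcases le_max_iff.1 (h (t • a)) with hle | hle
  · rw [ENNReal.ofReal_of_nonpos (by linarith [le_max_left ε (t * K)])]
    exact zero_le
  · calc ENNReal.ofReal (f (x + t • a) - (f x + max ε (t * K)))
        ≤ ENNReal.ofReal (t * (b * ‖a‖ - K)) :=
          ENNReal.ofReal_le_ofReal (by linarith [le_max_right ε (t * K)])
      _ = t * ENNReal.ofReal (b * ‖a‖ - K) := by
          rw [ENNReal.ofReal_mul t.coe_nonneg, ENNReal.ofReal_coe_nnreal]
      _ ≤ t * c a := by gcongr; exact conj_le_iff.1 hK a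

end Conjugate

section AdaptedIntegral

theorem abs_indicator_one_le_one {Ω : Type*} (B : Set Ω) (ω : Ω) :
    |B.indicator (fun _ => (1 : ℝ)) ω| ≤ 1 :=
  (norm_indicator_le_norm_self (fun _ => (1 : ℝ)) ω).trans norm_one.le

variable {E Ω S : Type*} [NormedAddCommGroup E] {m mΩ : MeasurableSpace Ω} {P : Measure Ω}

theorem abs_condProb_le_one (B : Set Ω) : ∀ᵐ ω ∂P, |(P⟦B | m⟧) ω| ≤ 1 :=
  ae_bdd_abs_condExp_of_ae_bdd_abs (R := 1) <| Eventually.of_forall (abs_indicator_one_le_one B)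

theorem aestronglyMeasurable_of_tendsto [CompleteSpace E] {X : ℕ → Ω → E} {A : Ω → E}
    (hX : ∀ n, AEStronglyMeasurable[m] (X n) P)
    (hlim : ∀ᵐ ω ∂P, Tendsto (fun n => X n ω) atTop (𝓝 (A ω))) : AEStronglyMeasurable[m] A P := by
  refine ⟨fun ω => limUnder atTop fun n => (hX n).mk _ ω,
    @StronglyMeasurable.limUnder _ _ _ m _ _ _ _ _ _ _ fun n => (hX n).stronglyMeasurable_mk, ?_⟩
  filter_upwards [hlim, ae_all_iff.2 fun n => (hX n).ae_eq_mk] with ω hω hmk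
  simp only [← hmk, hω.limUnder_eq]

variable [NormedSpace ℝ E]

theorem integral_indicator_one_smul {B : Set Ω} (hB : MeasurableSet B) (X : Ω → E) :
    ∫ ω, B.indicator (fun _ => (1 : ℝ)) ω • X ω ∂P = ∫ ω in B, X ω ∂P := by
  rw [← integral_indicator hB]
  simp only [one_smul, ← Set.indicator_smul_left]

theorem integral_smul_integral_swap [IsFiniteMeasure P] [MeasurableSpace S] {ν : Measure S}
    [SFinite ν] {β : S → Ω → E} (hβ : Integrable (Function.uncurry β) (ν.prod P)) {w : Ω → ℝ}
    (hw : AEStronglyMeasurable w P) {C : ℝ} (hC : ∀ᵐ ω ∂P, |w ω| ≤ C) :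
    ∫ ω, w ω • ∫ u, β u ω ∂ν ∂P = ∫ u, ∫ ω, w ω • β u ω ∂P ∂ν := by
  have hint : Integrable (fun z : S × Ω => w z.2 • Function.uncurry β z) (ν.prod P) :=
    hβ.bdd_smul C hw.comp_snd (Measure.quasiMeasurePreserving_snd.ae hC)
  simp only [← integral_smul]
  exact (integral_integral_swap hint).symm

variable [CompleteSpace E] [IsFiniteMeasure P]

theorem integral_condExp_smul (hm : m ≤ mΩ) {w : Ω → ℝ} {X : Ω → E} (hw : Integrable w P)
    (hX : AEStronglyMeasurable[m] X P) (hwX : Integrable (w • X) P) :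
    ∫ ω, P[w|m] ω • X ω ∂P = ∫ ω, w ω • X ω ∂P :=
  calc ∫ ω, P[w|m] ω • X ω ∂P = ∫ ω, P[w • X|m] ω ∂P :=
        integral_congr_ae (condExp_smul_of_aestronglyMeasurable_right hw hwX hX).symm
    _ = ∫ ω, w ω • X ω ∂P := integral_condExp hm

theorem integral_condProb_smul (hm : m ≤ mΩ) {B : Set Ω} (hB : MeasurableSet B) {X : Ω → E}
    (hX : AEStronglyMeasurable[m] X P) (hXi : Integrable X P) :
    ∫ ω, (P⟦B | m⟧) ω • X ω ∂P = ∫ ω in B, X ω ∂P := by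
  have hw : Integrable (B.indicator fun _ => (1 : ℝ)) P := (integrable_const 1).indicator hB
  have hwX : Integrable ((B.indicator fun _ => (1 : ℝ)) • X) P :=
    hXi.bdd_smul 1 hw.aestronglyMeasurable <| Eventually.of_forall (abs_indicator_one_le_one B)
  rw [integral_condExp_smul hm hw hX hwX, integral_indicator_one_smul hB]

theorem aestronglyMeasurable_of_setIntegral_eq (hm : m ≤ mΩ) {A : Ω → E} (hA : Integrable A P)
    (h : ∀ B, MeasurableSet B → ∫ ω in B, A ω ∂P = ∫ ω, (P⟦B | m⟧) ω • A ω ∂P) :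
    AEStronglyMeasurable[m] A P := by
  suffices hcond : A =ᵐ[P] P[A|m] from
    stronglyMeasurable_condExp.aestronglyMeasurable.congr hcond.symm
  refine hA.ae_eq_of_forall_setIntegral_eq _ _ integrable_condExp fun B hB _ => ?_
  have hpull : P[(P⟦B | m⟧) • A|m] =ᵐ[P] (P⟦B | m⟧) • P[A|m] :=
    condExp_smul_of_aestronglyMeasurable_left stronglyMeasurable_condExp.aestronglyMeasurable
      (hA.bdd_smul 1 integrable_condExp.aestronglyMeasurable (abs_condProb_le_one B)) hA
  calc ∫ ω in B, A ω ∂P = ∫ ω, P[(P⟦B | m⟧) • A|m] ω ∂P :=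
        (h B hB).trans (integral_condExp hm).symm
    _ = ∫ ω, (P⟦B | m⟧) ω • P[A|m] ω ∂P := integral_congr_ae hpull
    _ = ∫ ω in B, P[A|m] ω ∂P := integral_condProb_smul hm hB
        stronglyMeasurable_condExp.aestronglyMeasurable integrable_condExp

variable [MeasurableSpace S] {ν : Measure S}

theorem aestronglyMeasurable_integral_of_integrable_prod [SFinite ν] (hm : m ≤ mΩ)
    {β : S → Ω → E} (hβ : Integrable (Function.uncurry β) (ν.prod P))
    (hβm : ∀ᵐ u ∂ν, AEStronglyMeasurable[m] (β u) P) :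
    AEStronglyMeasurable[m] (fun ω => ∫ u, β u ω ∂ν) P := by
  refine aestronglyMeasurable_of_setIntegral_eq hm hβ.integral_prod_right fun B hB => ?_
  rw [integral_smul_integral_swap hβ integrable_condExp.aestronglyMeasurable
    (abs_condProb_le_one B), ← integral_indicator_one_smul hB, integral_smul_integral_swap hβ
    (stronglyMeasurable_const.indicator hB).aestronglyMeasurable (C := 1)
    (Eventually.of_forall (abs_indicator_one_le_one B))]
  refine integral_congr_ae ?_
  filter_upwards [hβm, hβ.prod_right_ae] with u hum hui
  rw [integral_condProb_smul hm hB hum hui, integral_indicator_one_smul hB]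

variable [MeasurableSpace E] [BorelSpace E] [SecondCountableTopology E]

theorem aestronglyMeasurable_integral [IsFiniteMeasure ν] (hm : m ≤ mΩ) {β : S → Ω → E}
    (hβ : Measurable (Function.uncurry β)) (hβm : ∀ᵐ u ∂ν, Measurable[m] (β u))
    (hi : ∀ᵐ ω ∂P, Integrable (fun u => β u ω) ν) :
    AEStronglyMeasurable[m] (fun ω => ∫ u, β u ω ∂ν) P := by
  let T (n : ℕ) : E → E := (Metric.closedBall (0 : E) n).indicator id
  have hTm n : Measurable (T n) := measurable_id.indicator Metric.isClosed_closedBall.measurableSet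
  have hTle n x : ‖T n x‖ ≤ n := by
    by_cases hx : x ∈ Metric.closedBall (0 : E) n
    · rw [show T n x = x from Set.indicator_of_mem hx _]
      exact mem_closedBall_zero_iff.1 hx
    · simp [T, hx]
  have hTlim x : Tendsto (fun n => T n x) atTop (𝓝 x) := by
    refine tendsto_const_nhds.congr' ?_
    filter_upwards [eventually_ge_atTop ⌈‖x‖⌉₊] with n hn
    simp [T, Nat.ceil_le.1 hn]
  refine aestronglyMeasurable_of_tendsto (X := fun n ω => ∫ u, T n (β u ω) ∂ν) (fun n => ?_) ?_
  · refine aestronglyMeasurable_integral_of_integrable_prod hm ?_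
      (hβm.mono fun u hu => ((hTm n).comp hu).stronglyMeasurable.aestronglyMeasurable)
    exact .of_bound ((hTm n).comp hβ).aestronglyMeasurable n
      (Eventually.of_forall fun z => hTle n _)
  · filter_upwards [hi] with ω hω
    exact tendsto_integral_of_dominated_convergence (fun u => ‖β u ω‖)
      (fun n => ((hTm n).comp (hβ.comp measurable_prodMk_right)).aestronglyMeasurable) hω.norm
      (fun n => Eventually.of_forall fun u => norm_indicator_le_norm_self _ _)
      (Eventually.of_forall fun u => hTlim _)

end AdaptedIntegral

section Independence

variable {E Ω : Type*} [NormedAddCommGroup E] [MeasurableSpace E] [BorelSpace E]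
  {m mΩ : MeasurableSpace Ω} {P : Measure Ω} {X D : Ω → E} {g : E → ℝ}

theorem indepFun_of_aestronglyMeasurable (hX : AEStronglyMeasurable[m] X P)
    (hD : Indep (MeasurableSpace.comap D inferInstance) m P) : IndepFun X D P := by
  refine IndepFun.congr ?_ hX.ae_eq_mk.symm .rfl
  exact (IndepFun_iff_Indep _ _ _).2
    (indep_of_indep_of_le_right hD hX.stronglyMeasurable_mk.measurable.comap_le).symm

variable [SecondCountableTopology E] [IsProbabilityMeasure P]

theorem integral_add_eq_integral_transition (hX : AEMeasurable X P) (hD : AEMeasurable D P)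
    (hXD : IndepFun X D P) (hg : IsUCb g) :
    ∫ ω, g (X ω + D ω) ∂P = ∫ ω, transition (P.map D) g (X ω) ∂P := by
  have := Measure.isProbabilityMeasure_map hX
  have := Measure.isProbabilityMeasure_map hD
  have hadd : Measurable fun z : E × E => z.1 + z.2 := measurable_fst.add measurable_snd
  have hTg : Continuous (transition (P.map D) g) :=
    ((isShiftMonotone_transition _).isUCb hg).1.continuous
  calc ∫ ω, g (X ω + D ω) ∂P = ∫ z, g (z.1 + z.2) ∂P.map fun ω => (X ω, D ω) :=
        (integral_map (hX.prodMk hD)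
          (hg.1.continuous.measurable.comp hadd).aestronglyMeasurable).symm
    _ = ∫ z, g (z.1 + z.2) ∂(P.map X).prod (P.map D) := by
        rw [(indepFun_iff_map_prod_eq_prod_map_map hX hD).1 hXD]
    _ = ∫ x, transition (P.map D) g x ∂P.map X :=
        integral_prod _ (hg.integrable_comp hadd.aemeasurable)
    _ = ∫ ω, transition (P.map D) g (X ω) ∂P :=
        integral_map hX hTg.measurable.aestronglyMeasurable

end Independence

section Jensen

variable {E : Type*} [NormedAddCommGroup E] {c : E → ℝ≥0∞}

/-- The lower semicontinuous envelope of a function. It stands in for the cost, which need not be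
measurable, wherever an integral has to be additive. -/
noncomputable def lscEnvelope (c : E → ℝ≥0∞) (a : E) : ℝ≥0∞ := liminf c (𝓝 a)

theorem lowerSemicontinuous_lscEnvelope : LowerSemicontinuous (lscEnvelope c) := by
  intro a r hr
  obtain ⟨q, hrq, hq⟩ := exists_between hr
  filter_upwards [(eventually_lt_of_lt_liminf hq).eventually_nhds] with b hb
  exact hrq.trans_le (le_liminf_of_le (by isBoundedDefault) (hb.mono fun _ h => h.le))

theorem lscEnvelope_le (a : E) : lscEnvelope c a ≤ c a := by
  have hpure : ∃ᶠ b in pure a, c b ≤ c a := frequently_pure.2 le_rfl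
  exact liminf_le_of_frequently_le (hpure.filter_mono (pure_le_nhds a)) (by isBoundedDefault)

/-- The epigraph of an extended nonnegative function, as a subset of `E × ℝ`. -/
def epigraph (c : E → ℝ≥0∞) : Set (E × ℝ) := {p | 0 ≤ p.2 ∧ c p.1 ≤ ENNReal.ofReal p.2}

theorem mem_closure_epigraph {a : E} (ha : lscEnvelope c a ≠ ⊤) :
    (a, (lscEnvelope c a).toReal) ∈ closure (epigraph c) := by
  rw [Metric.mem_closure_iff]
  intro ε hε
  have hlt : lscEnvelope c a < ENNReal.ofReal ((lscEnvelope c a).toReal + ε / 2) := by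
    rw [ENNReal.lt_ofReal_iff_toReal_lt ha]
    linarith
  obtain ⟨b, hb, hba⟩ := ((frequently_lt_of_liminf_lt (by isBoundedDefault) hlt).and_eventually
    (Metric.ball_mem_nhds a hε)).exists
  refine ⟨(b, _), ⟨by positivity, hb.le⟩, ?_⟩
  rw [Prod.dist_eq, max_lt_iff, dist_self_add_right, Real.norm_of_nonneg (half_pos hε).le]
  exact ⟨by rwa [dist_comm], half_lt_self hε⟩

variable [NormedSpace ℝ E]

theorem convex_epigraph (hc : ConvexOn ℝ≥0 Set.univ c) : Convex ℝ (epigraph c) := by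
  rintro ⟨x, r⟩ ⟨hr : 0 ≤ r, hx : c x ≤ ENNReal.ofReal r⟩ ⟨y, q⟩
    ⟨hq : 0 ≤ q, hy : c y ≤ ENNReal.ofReal q⟩ a b ha hb hab
  lift a to ℝ≥0 using ha
  lift b to ℝ≥0 using hb
  refine ⟨add_nonneg (mul_nonneg a.coe_nonneg hr) (mul_nonneg b.coe_nonneg hq), ?_⟩
  calc c (a • x + b • y) ≤ a • c x + b • c y :=
        hc.2 (Set.mem_univ x) (Set.mem_univ y) zero_le zero_le (by exact_mod_cast hab)
    _ ≤ a • ENNReal.ofReal r + b • ENNReal.ofReal q := by gcongr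
    _ = ENNReal.ofReal (a * r + b * q) := by
        rw [ENNReal.ofReal_add (by positivity) (by positivity),
          ENNReal.ofReal_mul a.coe_nonneg, ENNReal.ofReal_mul b.coe_nonneg]
        simp only [ENNReal.smul_def, smul_eq_mul, ENNReal.ofReal_coe_nnreal]

variable {t : ℝ≥0} {f : E → ℝ}

theorem sub_hopfLax_le_of_mem_closure_epigraph (h0 : c 0 = 0) (hf : Continuous f)
    (hb : BddAbove (Set.range f)) (x : E) {p : E × ℝ} (hp : p ∈ closure (epigraph c)) :
    f (x + (t : ℝ) • p.1) - hopfLax c t f x ≤ t * p.2 := by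
  refine closure_minimal (t := {p : E × ℝ | f (x + (t : ℝ) • p.1) - hopfLax c t f x ≤ t * p.2})
    ?_ (isClosed_le (by fun_prop) (by fun_prop)) hp
  rintro ⟨a, r⟩ ⟨hr : 0 ≤ r, ha : c a ≤ ENNReal.ofReal r⟩
  refine (ENNReal.ofReal_le_ofReal_iff (mul_nonneg t.coe_nonneg hr)).1 ?_
  calc ENNReal.ofReal (f (x + t • a) - hopfLax c t f x) ≤ t * c a := ofReal_sub_hopfLax_le h0 hb a
    _ ≤ t * ENNReal.ofReal r := by gcongr
    _ = ENNReal.ofReal (t * r) := by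
        rw [ENNReal.ofReal_mul t.coe_nonneg, ENNReal.ofReal_coe_nnreal]

variable [CompleteSpace E] [MeasurableSpace E] [BorelSpace E] {S : Type*} [MeasurableSpace S]
  {ν : Measure S} [IsFiniteMeasure ν] {β : S → E}

theorem average_mem_closure_epigraph [NeZero ν] (hc : ConvexOn ℝ≥0 Set.univ c)
    (hβm : Measurable β) (hβ : Integrable β ν) (hcost : ∫⁻ u, lscEnvelope c (β u) ∂ν ≠ ⊤) :
    (⨍ u, β u ∂ν, ⨍ u, (lscEnvelope c (β u)).toReal ∂ν) ∈ closure (epigraph c) := by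
  have hm : Measurable fun u => lscEnvelope c (β u) :=
    lowerSemicontinuous_lscEnvelope.measurable.comp hβm
  have hi := integrable_toReal_of_lintegral_ne_top hm.aemeasurable hcost
  rw [← average_pair hβ hi]
  exact (convex_epigraph hc).closure.average_mem isClosed_closure
    ((ae_lt_top hm hcost).mono fun u hu => mem_closure_epigraph hu.ne) (hβ.prodMk hi)

theorem ofReal_sub_hopfLax_le_lintegral (hc : ConvexOn ℝ≥0 Set.univ c) (h0 : c 0 = 0)
    (hf : Continuous f) (hb : BddAbove (Set.range f)) (hβm : Measurable β) (hβ : Integrable β ν)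
    (hν : ν Set.univ = t) (x : E) :
    ENNReal.ofReal (f (x + ∫ u, β u ∂ν) - hopfLax c t f x) ≤ ∫⁻ u, c (β u) ∂ν := by
  refine le_trans ?_ (lintegral_mono fun u => lscEnvelope_le (β u))
  rcases eq_zero_or_neZero ν with rfl | hν0
  · obtain rfl : t = 0 := by simpa using hν.symm
    simp [hopfLax_zero]
  rcases eq_or_ne (∫⁻ u, lscEnvelope c (β u) ∂ν) ⊤ with htop | hcost
  · exact htop ▸ le_top
  have hm : Measurable fun u => lscEnvelope c (β u) :=
    lowerSemicontinuous_lscEnvelope.measurable.comp hβm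
  have hmass : ν.real Set.univ = t := by simp [Measure.real, hν]
  have hjensen := sub_hopfLax_le_of_mem_closure_epigraph (t := t) h0 hf hb x
    (average_mem_closure_epigraph hc hβm hβ hcost)
  rw [← smul_eq_mul (t : ℝ), ← hmass, measure_smul_average, measure_smul_average,
    integral_toReal hm.aemeasurable (ae_lt_top hm hcost)] at hjensen
  exact (ENNReal.ofReal_le_iff_le_toReal hcost).2 hjensen

end Jensen

section Expectation

variable {a b : ℝ} {k : ℝ≥0∞} {v : EReal}

theorem sub_coe_ennreal_add (x : EReal) (l k : ℝ≥0∞) :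
    x - ((l + k : ℝ≥0∞) : EReal) = x - (k : EReal) - (l : EReal) := by
  rw [EReal.coe_ennreal_add, sub_eq_add_neg, EReal.neg_add (by simp) (by simp), sub_eq_add_neg,
    sub_eq_add_neg, sub_eq_add_neg, add_assoc, add_comm (-(l : EReal))]

theorem coe_le_coe_sub_coe_ennreal (hba : b ≤ a) (h : k ≤ ENNReal.ofReal (a - b)) :
    (b : EReal) ≤ (a : EReal) - (k : EReal) := by
  lift k to ℝ≥0 using ne_top_of_le_ne_top ENNReal.ofReal_ne_top h
  rw [ENNReal.le_ofReal_iff_toReal_le ENNReal.coe_ne_top (sub_nonneg.2 hba),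
    ENNReal.coe_toReal] at h
  change (b : EReal) ≤ ((a - k : ℝ) : EReal)
  exact EReal.coe_le_coe_iff.2 (by linarith)

theorem coe_sub_le_of_forall_lt (h : ∀ r < b, (r : EReal) - (k : EReal) ≤ v) :
    (b : EReal) - (k : EReal) ≤ v := by
  rcases eq_or_ne k ⊤ with rfl | hk
  · simp
  · simp only [EReal.sub_le_iff_le_add, ne_eq, EReal.coe_ennreal_eq_top_iff, hk, not_false_eq_true,
      true_or, EReal.coe_ennreal_ne_bot] at h ⊢
    exact EReal.ge_of_forall_gt_iff_ge.1 fun r hr => h r (EReal.coe_lt_coe_iff.1 hr)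

variable {Ω : Type*} {mΩ : MeasurableSpace Ω} {P : Measure Ω} {u w : Ω → ℝ} {κ : Ω → ℝ≥0∞}

theorem ofReal_integral_sub_integral_le_lintegral (hu : Integrable u P) (hw : Integrable w P)
    (h : ∀ᵐ ω ∂P, ENNReal.ofReal (u ω - w ω) ≤ κ ω) :
    ENNReal.ofReal (∫ ω, u ω ∂P - ∫ ω, w ω ∂P) ≤ ∫⁻ ω, κ ω ∂P := by
  refine (ENNReal.ofReal_le_of_le_toReal ?_).trans (lintegral_mono_ae h)
  rw [← integral_sub hu hw,
    integral_eq_lintegral_pos_part_sub_lintegral_neg_part (f := fun ω => u ω - w ω) (hu.sub hw)]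
  exact sub_le_self _ ENNReal.toReal_nonneg

theorem lintegral_le_ofReal_integral_sub_integral (hu : Integrable u P) (hw : Integrable w P)
    (hwu : ∀ ω, w ω ≤ u ω) (h : ∀ ω, κ ω ≤ ENNReal.ofReal (u ω - w ω)) :
    ∫⁻ ω, κ ω ∂P ≤ ENNReal.ofReal (∫ ω, u ω ∂P - ∫ ω, w ω ∂P) := by
  rw [← integral_sub hu hw, ofReal_integral_eq_lintegral_ofReal
    (f := fun ω => u ω - w ω) (hu.sub hw) (Eventually.of_forall fun ω => sub_nonneg.2 (hwu ω))]
  exact lintegral_mono h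

end Expectation

section Payoff

variable {E Ω : Type*} {Y α : ℝ≥0 → Ω → E} {s h : ℝ≥0}

theorem runningCost_add (c : E → ℝ≥0∞) (α : ℝ≥0 → Ω → E) (s h : ℝ≥0) (ω : Ω) :
    runningCost c α (s + h) ω =
      runningCost c α s ω + ∫⁻ u in Set.Ioc (s : ℝ) (s + h : ℝ≥0), c (α u.toNNReal ω) := by
  rw [runningCost, ← Set.Ioc_union_Ioc_eq_Ioc s.coe_nonneg (NNReal.coe_le_coe.2 le_self_add),
    lintegral_union measurableSet_Ioc (Set.Ioc_disjoint_Ioc_of_le le_rfl), runningCost]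

variable [NormedAddCommGroup E] [NormedSpace ℝ E]

theorem controlled_add (Y : ℝ≥0 → Ω → E) {ω : Ω}
    (hi : IntegrableOn (fun u : ℝ => α u.toNNReal ω) (Set.Ioc 0 (s + h : ℝ≥0))) (x : E) :
    controlled Y α x (s + h) ω = controlled Y α x s ω + (Y (s + h) ω - Y s ω) +
      ∫ u in Set.Ioc (s : ℝ) (s + h : ℝ≥0), α u.toNNReal ω := by
  have hs : (s : ℝ) ≤ (s + h : ℝ≥0) := NNReal.coe_le_coe.2 le_self_add
  rw [controlled, ← Set.Ioc_union_Ioc_eq_Ioc s.coe_nonneg hs,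
    setIntegral_union (Set.Ioc_disjoint_Ioc_of_le le_rfl) measurableSet_Ioc
      (hi.mono_set (Set.Ioc_subset_Ioc_right hs))
      (hi.mono_set (Set.Ioc_subset_Ioc_left s.coe_nonneg)), controlled]
  abel

variable {mΩ : MeasurableSpace Ω} {P : Measure Ω}

/-- The expected payoff of the control `α`, which `value` maximizes over all controls. -/
noncomputable def payoff (P : Measure Ω) (Y : ℝ≥0 → Ω → E) (c : E → ℝ≥0∞) (α : ℝ≥0 → Ω → E)
    (t : ℝ≥0) (f : E → ℝ) (x : E) : EReal :=
  ((∫ ω, f (controlled Y α x t ω) ∂P : ℝ) : EReal) -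
    ((∫⁻ ω, runningCost c α t ω ∂P : ℝ≥0∞) : EReal)

theorem payoff_zero {c : E → ℝ≥0∞} {f : E → ℝ} {x : E} [IsProbabilityMeasure P]
    (hY : ∀ᵐ ω ∂P, Y 0 ω = 0) : payoff P Y c α 0 f x = f x := by
  have hstart : ∫ ω, f (controlled Y α x 0 ω) ∂P = ∫ _, f x ∂P :=
    integral_congr_ae (hY.mono fun ω hω => by simp [controlled, hω])
  simp [payoff, runningCost, hstart]

end Payoff

section Control

variable {E Ω : Type*} [NormedAddCommGroup E] [MeasurableSpace E] {mΩ : MeasurableSpace Ω}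
  {P : Measure Ω} {ℱ : Filtration ℝ≥0 mΩ} {Y α : ℝ≥0 → Ω → E} {c : E → ℝ≥0∞} {s h : ℝ≥0}

/-- Adapted processes started at `0` with stationary increments independent of the past: the
structure of a Lévy process that dynamic programming rests on. -/
structure HasStationaryIndepIncrements (P : Measure Ω) (ℱ : Filtration ℝ≥0 mΩ)
    (Y : ℝ≥0 → Ω → E) : Prop where
  adapted : Adapted ℱ Y
  zero : ∀ᵐ ω ∂P, Y 0 ω = 0
  indep : ∀ s t : ℝ≥0, s ≤ t →
    Indep (MeasurableSpace.comap (fun ω => Y t ω - Y s ω) inferInstance) (ℱ s) P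
  stationary : ∀ s t : ℝ≥0, IdentDistrib (fun ω => Y (s + t) ω - Y s ω) (Y t) P P

theorem IsLevyProcess.hasStationaryIndepIncrements [BorelSpace E] (hY : IsLevyProcess P ℱ Y) :
    HasStationaryIndepIncrements P ℱ Y :=
  ⟨hY.adapted, hY.zero, hY.indep, hY.stationary⟩

theorem HasStationaryIndepIncrements.map_zero [IsProbabilityMeasure P]
    (hY : HasStationaryIndepIncrements P ℱ Y) : P.map (Y 0) = Measure.dirac 0 := by
  rw [Measure.map_congr hY.zero, Measure.map_const, measure_univ, one_smul]

theorem HasStationaryIndepIncrements.isShiftMonotone_transition [BorelSpace E]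
    [IsProbabilityMeasure P] (hY : HasStationaryIndepIncrements P ℱ Y) (h : ℝ≥0) :
    IsShiftMonotone (transition (P.map (Y h))) :=
  have := Measure.isProbabilityMeasure_map (hY.stationary 0 h).aemeasurable_snd
  LevyControl.isShiftMonotone_transition _

theorem HasStationaryIndepIncrements.integral_comp_add_increment [BorelSpace E]
    [SecondCountableTopology E] [IsProbabilityMeasure P]
    (hY : HasStationaryIndepIncrements P ℱ Y) {X : Ω → E} (hX : AEStronglyMeasurable[ℱ s] X P)
    {g : E → ℝ} (hg : IsUCb g) :
    ∫ ω, g (X ω + (Y (s + h) ω - Y s ω)) ∂P = ∫ ω, transition (P.map (Y h)) g (X ω) ∂P := by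
  have hstat := hY.stationary s h
  rw [← hstat.map_eq]
  exact integral_add_eq_integral_transition (hX.mono (ℱ.le s)).aemeasurable hstat.aemeasurable_fst
    (indepFun_of_aestronglyMeasurable hX (hY.indep s _ le_self_add)) hg

theorem isControl_zero : IsControl P ℱ (0 : ℝ≥0 → Ω → E) :=
  ⟨measurable_const, fun _ => measurable_const, by simp⟩

namespace IsControl

theorem measurable_toNNReal (hα : IsControl P ℱ α) :
    Measurable (Function.uncurry fun (u : ℝ) ω => α u.toNNReal ω) :=
  hα.measurable.comp ((measurable_real_toNNReal.comp measurable_fst).prodMk measurable_snd)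

theorem measurable_path (hα : IsControl P ℱ α) (ω : Ω) :
    Measurable fun u : ℝ => α u.toNNReal ω :=
  hα.measurable_toNNReal.comp measurable_prodMk_right

theorem integrableOn [BorelSpace E] [SecondCountableTopology E] (hα : IsControl P ℱ α) :
    ∀ᵐ ω ∂P, ∀ t : ℝ≥0, IntegrableOn (fun u : ℝ => α u.toNNReal ω) (Set.Ioc 0 t) :=
  hα.integrable.mono fun ω hω t => ⟨(hα.measurable_path ω).aestronglyMeasurable, hω t⟩

theorem aestronglyMeasurable_controlled [NormedSpace ℝ E] [CompleteSpace E] [BorelSpace E]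
    [SecondCountableTopology E] [IsFiniteMeasure P] (hα : IsControl P ℱ α) (hY : Adapted ℱ Y)
    (x : E) (s : ℝ≥0) : AEStronglyMeasurable[ℱ s] (controlled Y α x s) P := by
  refine ((hY s).const_add x).stronglyMeasurable.aestronglyMeasurable.add ?_
  refine aestronglyMeasurable_integral (ℱ.le s) hα.measurable_toNNReal ?_
    (hα.integrableOn.mono fun ω hω => hω s)
  filter_upwards [ae_restrict_mem measurableSet_Ioc] with u hu
  exact (hα.adapted _).mono (ℱ.mono (Real.toNNReal_le_iff_le_coe.2 hu.2)) le_rfl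

end IsControl

variable [NormedSpace ℝ E] {t : ℝ≥0} {f : E → ℝ} {x : E} {v : EReal}

theorem value_le_iff : value P ℱ Y c t f x ≤ v ↔
    ∀ α : ℝ≥0 → Ω → E, IsControl P ℱ α → payoff P Y c α t f x ≤ v :=
  iSup₂_le_iff

theorem payoff_le_value (hα : IsControl P ℱ α) :
    payoff P Y c α t f x ≤ value P ℱ Y c t f x :=
  value_le_iff.1 le_rfl α hα

theorem value_zero [IsProbabilityMeasure P] (hY : ∀ᵐ ω ∂P, Y 0 ω = 0) :
    value P ℱ Y c 0 f x = f x :=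
  le_antisymm (value_le_iff.2 fun _ _ => (payoff_zero hY).le)
    ((payoff_zero hY).ge.trans (payoff_le_value isControl_zero))

end Control

section Selection

variable {E : Type*} [NormedAddCommGroup E] [NormedSpace ℝ E] [SecondCountableTopology E]
  [MeasurableSpace E] {c : E → ℝ≥0∞} {h : ℝ≥0} {G : E → ℝ} {ε : ℝ}

theorem exists_measurable_nearly_optimal_velocity [OpensMeasurableSpace E] (h0 : c 0 = 0)
    (hG : IsUCb G) (hε : 0 < ε) :
    ∃ ξ : E → E, Measurable ξ ∧ Measurable (c ∘ ξ) ∧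
      ∀ x, h * c (ξ x) < ENNReal.ofReal (G (x + h • ξ x) - (hopfLax c h G x - ε)) := by
  classical
  obtain ⟨δ₁, hδ₁, hGδ⟩ := Metric.uniformContinuous_iff.1 hG.1 (ε / 3) (by positivity)
  obtain ⟨δ₂, hδ₂, hΦδ⟩ := Metric.uniformContinuous_iff.1
    ((isShiftMonotone_hopfLax (t := h) h0).isUCb hG).1 (ε / 3) (by positivity)
  let z : ℕ → E := TopologicalSpace.denseSeq E
  have hoptimal n : ∃ b, h * c b <
      ENNReal.ofReal (G (z n + h • b) - (hopfLax c h G (z n) - ε / 3)) :=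
    (lt_hopfLax_iff h0 hG.bddAbove_range).1 (by linarith)
  choose b hb using hoptimal
  have hnear x : ∃ n, dist x (z n) < min δ₁ δ₂ := by
    obtain ⟨_, hy, n, rfl⟩ := Metric.dense_iff.1 (TopologicalSpace.denseRange_denseSeq E) x
      (min δ₁ δ₂) (lt_min hδ₁ hδ₂)
    exact ⟨n, by rwa [dist_comm]⟩
  have hfind : Measurable fun x => Nat.find (hnear x) := measurable_find hnear fun n =>
    measurableSet_lt (measurable_id.dist measurable_const) measurable_const
  refine ⟨fun x => b (Nat.find (hnear x)), (measurable_from_nat (f := b)).comp hfind,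
    (measurable_from_nat (f := c ∘ b)).comp hfind, fun x => ?_⟩
  have hx := Nat.find_spec (hnear x)
  set n := Nat.find (hnear x)
  have hGx := hGδ (a := x + h • b n) (b := z n + h • b n)
    (by rw [dist_add_right]; exact hx.trans_le (min_le_left _ _))
  have hΦx := hΦδ (hx.trans_le (min_le_right _ _))
  rw [Real.dist_eq, abs_lt] at hGx hΦx
  exact (hb n).trans_le (ENNReal.ofReal_le_ofReal (by linarith [hGx.1, hΦx.2]))

theorem exists_measurable_coe_le_integral_sub_lintegral [BorelSpace E] {Ω : Type*}
    {m mΩ : MeasurableSpace Ω} {P : Measure Ω} [IsProbabilityMeasure P] {X : Ω → E} {r : ℝ}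
    (h0 : c 0 = 0) (hm : m ≤ mΩ) (hX : AEStronglyMeasurable[m] X P) (hG : IsUCb G)
    (hr : r < ∫ ω, hopfLax c h G (X ω) ∂P) :
    ∃ ξ : Ω → E, Measurable[m] ξ ∧ Measurable[m] (c ∘ ξ) ∧
      (r : EReal) ≤ ((∫ ω, G (X ω + h • ξ ω) ∂P : ℝ) : EReal) -
        ((∫⁻ ω, h * c (ξ ω) ∂P : ℝ≥0∞) : EReal) := by
  have hΦG := (isShiftMonotone_hopfLax (t := h) h0).isUCb hG
  obtain ⟨X', hX', hXX'⟩ := hX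
  have hX'm : Measurable X' := hX'.measurable.mono hm le_rfl
  rw [integral_congr_ae (hXX'.mono fun ω hω => congrArg (hopfLax c h G) hω)] at hr
  set ε := ∫ ω, hopfLax c h G (X' ω) ∂P - r with hε_def
  obtain ⟨v, hv, hcv, hopt⟩ :=
    exists_measurable_nearly_optimal_velocity (h := h) h0 hG (sub_pos.2 hr : 0 < ε)
  have hu : Integrable (fun ω => G (X' ω + h • v (X' ω))) P :=
    hG.integrable_comp (hX'm.add ((hv.comp hX'm).const_smul h)).aemeasurable
  have hΦ : Integrable (fun ω => hopfLax c h G (X' ω)) P :=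
    hΦG.integrable_comp hX'm.aemeasurable
  have hw : Integrable (fun ω => hopfLax c h G (X' ω) - ε) P := hΦ.sub (integrable_const ε)
  have hwu ω : hopfLax c h G (X' ω) - ε ≤ G (X' ω + h • v (X' ω)) :=
    (sub_pos.1 (ENNReal.ofReal_pos.1 (pos_of_gt (hopt (X' ω))))).le
  have hgain := coe_le_coe_sub_coe_ennreal (integral_mono hw hu hwu)
    (lintegral_le_ofReal_integral_sub_integral hu hw hwu fun ω => (hopt (X' ω)).le)
  have hw_eq : ∫ ω, (hopfLax c h G (X' ω) - ε) ∂P = r := by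
    rw [integral_sub hΦ (integrable_const ε), integral_const, probReal_univ, one_smul, hε_def,
      sub_sub_cancel]
  have hstate : ∫ ω, G (X ω + h • v (X' ω)) ∂P = ∫ ω, G (X' ω + h • v (X' ω)) ∂P :=
    integral_congr_ae (hXX'.mono fun ω hω => by simp only [hω])
  rw [hw_eq, ← hstate] at hgain
  exact ⟨v ∘ X', hv.comp hX'.measurable, hcv.comp hX'.measurable, hgain⟩

end Selection

section SwitchControl

variable {E Ω : Type*} {α : ℝ≥0 → Ω → E} {s h : ℝ≥0} {ξ : Ω → E}

/-- The control that follows `α` up to time `s` and has the constant value `ξ` afterwards. -/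
noncomputable def switchControl (α : ℝ≥0 → Ω → E) (s : ℝ≥0) (ξ : Ω → E) (u : ℝ≥0) (ω : Ω) : E :=
  if u ≤ s then α u ω else ξ ω

theorem switchControl_of_le {u : ℝ} (hu : u ≤ s) (ω : Ω) :
    switchControl α s ξ u.toNNReal ω = α u.toNNReal ω :=
  if_pos (Real.toNNReal_le_iff_le_coe.2 hu)

theorem switchControl_of_lt {u : ℝ} (hu : s < u) (ω : Ω) :
    switchControl α s ξ u.toNNReal ω = ξ ω :=
  if_neg (Real.lt_toNNReal_iff_coe_lt.2 hu).not_ge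

theorem runningCost_switchControl (c : E → ℝ≥0∞) (ω : Ω) :
    runningCost c (switchControl α s ξ) (s + h) ω = runningCost c α s ω + h * c (ξ ω) := by
  rw [runningCost_add, runningCost, setLIntegral_congr_fun measurableSet_Ioc fun u hu => by
    rw [switchControl_of_le hu.2], setLIntegral_congr_fun (s := Set.Ioc (s : ℝ) _)
    measurableSet_Ioc fun u hu => by rw [switchControl_of_lt hu.1], runningCost]
  simp [mul_comm]

variable [NormedAddCommGroup E]

theorem controlled_switchControl [NormedSpace ℝ E] [CompleteSpace E] (Y : ℝ≥0 → Ω → E) {ω : Ω}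
    (hi : IntegrableOn (fun u : ℝ => switchControl α s ξ u.toNNReal ω) (Set.Ioc 0 (s + h : ℝ≥0)))
    (x : E) : controlled Y (switchControl α s ξ) x (s + h) ω =
      controlled Y α x s ω + h • ξ ω + (Y (s + h) ω - Y s ω) := by
  rw [controlled_add Y hi, controlled, setIntegral_congr_fun measurableSet_Ioc fun u hu => by
    rw [switchControl_of_le hu.2], setIntegral_congr_fun (s := Set.Ioc (s : ℝ) _)
    measurableSet_Ioc fun u hu => by rw [switchControl_of_lt hu.1], setIntegral_const,
    Real.volume_real_Ioc, NNReal.coe_add, add_sub_cancel_left, max_eq_left h.coe_nonneg,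
    NNReal.smul_def, controlled]
  abel

variable [MeasurableSpace E] {mΩ : MeasurableSpace Ω} {P : Measure Ω} {ℱ : Filtration ℝ≥0 mΩ}

theorem IsControl.switchControl (hα : IsControl P ℱ α) (hξ : Measurable[ℱ s] ξ) :
    IsControl P ℱ (switchControl α s ξ) where
  measurable := (hα.measurable).ite (measurable_fst measurableSet_Iic)
    ((hξ.mono (ℱ.le s) le_rfl).comp measurable_snd)
  adapted u := by
    rcases le_or_gt u s with hu | hu
    · rw [show LevyControl.switchControl α s ξ u = α u from funext fun ω => if_pos hu]
      exact hα.adapted u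
    · rw [show LevyControl.switchControl α s ξ u = ξ from funext fun ω => if_neg hu.not_ge]
      exact hξ.mono (ℱ.mono hu.le) le_rfl
  integrable := by
    filter_upwards [hα.integrable] with ω hω t
    calc ∫⁻ u in Set.Ioc (0 : ℝ) t, ‖LevyControl.switchControl α s ξ u.toNNReal ω‖ₑ
        ≤ ∫⁻ u in Set.Ioc (0 : ℝ) t, (‖α u.toNNReal ω‖ₑ + ‖ξ ω‖ₑ) := by
          refine lintegral_mono fun u => ?_
          unfold LevyControl.switchControl
          split_ifs
          · exact le_self_add
          · exact le_add_self
      _ = (∫⁻ u in Set.Ioc (0 : ℝ) t, ‖α u.toNNReal ω‖ₑ) + ‖ξ ω‖ₑ * t := by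
          rw [lintegral_add_right _ measurable_const]; simp
      _ < ⊤ := ENNReal.add_lt_top.2 ⟨hω t, ENNReal.mul_lt_top (by simp) (by simp)⟩

end SwitchControl

section DynamicProgramming

variable {E Ω : Type*} [NormedAddCommGroup E] [NormedSpace ℝ E] [CompleteSpace E]
  [SecondCountableTopology E] [MeasurableSpace E] [BorelSpace E] {mΩ : MeasurableSpace Ω}
  {P : Measure Ω} [IsProbabilityMeasure P] {ℱ : Filtration ℝ≥0 mΩ} {Y α : ℝ≥0 → Ω → E}
  {c : E → ℝ≥0∞} {s h : ℝ≥0} {g : E → ℝ}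

theorem payoff_add_le_payoff_transition_hopfLax (hc : ConvexOn ℝ≥0 Set.univ c) (h0 : c 0 = 0)
    (hY : HasStationaryIndepIncrements P ℱ Y) (hα : IsControl P ℱ α) (hg : IsUCb g) (x : E) :
    payoff P Y c α (s + h) g x ≤
      payoff P Y c α s (transition (P.map (Y h)) (hopfLax c h g)) x := by
  have hX t := hα.aestronglyMeasurable_controlled hY.adapted x t
  have hΦg := (isShiftMonotone_hopfLax (t := h) h0).isUCb hg
  have hjensen : ∀ᵐ ω ∂P, ENNReal.ofReal (g (controlled Y α x (s + h) ω) -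
      hopfLax c h g (controlled Y α x s ω + (Y (s + h) ω - Y s ω))) ≤
      ∫⁻ u in Set.Ioc (s : ℝ) (s + h : ℝ≥0), c (α u.toNNReal ω) ∂volume := by
    filter_upwards [hα.integrableOn] with ω hω
    rw [controlled_add Y (hω _)]
    exact ofReal_sub_hopfLax_le_lintegral hc h0 hg.1.continuous hg.bddAbove_range
      (hα.measurable_path ω) ((hω _).mono_set (Set.Ioc_subset_Ioc_left s.coe_nonneg))
      (by simp) _
  have hgain := ofReal_integral_sub_integral_le_lintegral
    (hg.integrable_comp ((hX _).mono (ℱ.le _)).aemeasurable)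
    (hΦg.integrable_comp (X := fun ω => controlled Y α x s ω + (Y (s + h) ω - Y s ω))
      (((hX s).mono (ℱ.le s)).aemeasurable.add (hY.stationary s h).aemeasurable_fst)) hjensen
  rw [hY.integral_comp_add_increment (hX s) hΦg] at hgain
  simp only [payoff, runningCost_add]
  refine (EReal.sub_le_sub le_rfl
    (EReal.coe_ennreal_le_coe_ennreal_iff.2 (le_lintegral_add _ _))).trans ?_
  rw [sub_coe_ennreal_add]
  exact EReal.sub_le_sub (coe_sub_coe_ennreal_le_coe_iff.2 hgain) le_rfl

theorem payoff_switchControl (hY : HasStationaryIndepIncrements P ℱ Y) (hα : IsControl P ℱ α)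
    {ξ : Ω → E} (hξ : Measurable[ℱ s] ξ) (hcξ : Measurable (c ∘ ξ)) (hg : IsUCb g) (x : E) :
    payoff P Y c (switchControl α s ξ) (s + h) g x =
      ((∫ ω, transition (P.map (Y h)) g (controlled Y α x s ω + h • ξ ω) ∂P : ℝ) : EReal) -
        ((∫⁻ ω, h * c (ξ ω) ∂P : ℝ≥0∞) : EReal) -
        ((∫⁻ ω, runningCost c α s ω ∂P : ℝ≥0∞) : EReal) := by
  have hstate : ∀ᵐ ω ∂P, g (controlled Y (switchControl α s ξ) x (s + h) ω) =
      g (controlled Y α x s ω + h • ξ ω + (Y (s + h) ω - Y s ω)) :=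
    (hα.switchControl hξ).integrableOn.mono fun ω hω => by
      rw [controlled_switchControl Y (hω _)]
  have hXξ : AEStronglyMeasurable[ℱ s] (fun ω => controlled Y α x s ω + h • ξ ω) P :=
    (hα.aestronglyMeasurable_controlled hY.adapted x s).add
      (hξ.const_smul h).stronglyMeasurable.aestronglyMeasurable
  simp only [payoff, runningCost_switchControl]
  rw [integral_congr_ae hstate, hY.integral_comp_add_increment hXξ hg,
    lintegral_add_right _ (g := fun ω => h * c (ξ ω)) (hcξ.const_mul _), sub_coe_ennreal_add]

theorem payoff_hopfLax_transition_le_value (h0 : c 0 = 0)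
    (hY : HasStationaryIndepIncrements P ℱ Y) (hα : IsControl P ℱ α) (hg : IsUCb g) (x : E) :
    payoff P Y c α s (hopfLax c h (transition (P.map (Y h)) g)) x ≤
      value P ℱ Y c (s + h) g x := by
  refine coe_sub_le_of_forall_lt fun r hr => ?_
  obtain ⟨ξ, hξ, hcξ, hgain⟩ := exists_measurable_coe_le_integral_sub_lintegral h0 (ℱ.le s)
    (hα.aestronglyMeasurable_controlled hY.adapted x s)
    ((hY.isShiftMonotone_transition h).isUCb hg) hr
  calc (r : EReal) - ((∫⁻ ω, runningCost c α s ω ∂P : ℝ≥0∞) : EReal)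
      ≤ payoff P Y c (switchControl α s ξ) (s + h) g x := by
        rw [payoff_switchControl hY hα hξ (hcξ.mono (ℱ.le s) le_rfl) hg]
        exact EReal.sub_le_sub hgain le_rfl
    _ ≤ value P ℱ Y c (s + h) g x := payoff_le_value (hα.switchControl hξ)

theorem value_add_le_value_transition_hopfLax (hc : ConvexOn ℝ≥0 Set.univ c) (h0 : c 0 = 0)
    (hY : HasStationaryIndepIncrements P ℱ Y) (hg : IsUCb g) (x : E) :
    value P ℱ Y c (s + h) g x ≤
      value P ℱ Y c s (transition (P.map (Y h)) (hopfLax c h g)) x :=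
  value_le_iff.2 fun _ hα => (payoff_add_le_payoff_transition_hopfLax hc h0 hY hα hg x).trans
    (payoff_le_value hα)

theorem value_hopfLax_transition_le_value_add (h0 : c 0 = 0)
    (hY : HasStationaryIndepIncrements P ℱ Y) (hg : IsUCb g) (x : E) :
    value P ℱ Y c s (hopfLax c h (transition (P.map (Y h)) g)) x ≤
      value P ℱ Y c (s + h) g x :=
  value_le_iff.2 fun _ hα => payoff_hopfLax_transition_le_value h0 hY hα hg x

end DynamicProgramming

section Squeeze

variable {ι : Type*} {S : Set ι} {a b : ι → ℝ} {v : EReal}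

theorem isLUB_and_isGLB_of_squeeze (ha : ∀ n ∈ S, (a n : EReal) ≤ v) (hb : ∀ n ∈ S, v ≤ b n)
    (hgap : ∀ ε > 0, ∃ n ∈ S, |b n - a n| ≤ ε) :
    IsLUB ((fun n => (a n : EReal)) '' S) v ∧ IsGLB ((fun n => (b n : EReal)) '' S) v := by
  obtain ⟨m, hm, -⟩ := hgap 1 one_pos
  lift v to ℝ using ⟨ne_top_of_le_ne_top (EReal.coe_ne_top _) (hb m hm),
    ne_bot_of_le_ne_bot (EReal.coe_ne_bot _) (ha m hm)⟩
  simp only [EReal.coe_le_coe_iff] at ha hb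
  refine ⟨⟨Set.forall_mem_image.2 fun n hn => EReal.coe_le_coe_iff.2 (ha n hn), fun u hu => ?_⟩,
    ⟨Set.forall_mem_image.2 fun n hn => EReal.coe_le_coe_iff.2 (hb n hn), fun u hu => ?_⟩⟩
  · refine EReal.ge_of_forall_gt_iff_ge.1 fun r hr => ?_
    obtain ⟨n, hn, hab⟩ := hgap (v - r) (sub_pos.2 (EReal.coe_lt_coe_iff.1 hr))
    refine le_trans (EReal.coe_le_coe_iff.2 ?_) (hu (Set.mem_image_of_mem _ hn))
    linarith [hb n hn, le_abs_self (b n - a n)]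
  · refine EReal.le_of_forall_lt_iff_le.1 fun r hr => ?_
    obtain ⟨n, hn, hab⟩ := hgap (r - v) (sub_pos.2 (EReal.coe_lt_coe_iff.1 hr))
    refine le_trans (hu (Set.mem_image_of_mem _ hn)) (EReal.coe_le_coe_iff.2 ?_)
    linarith [ha n hn, le_abs_self (b n - a n)]

end Squeeze

section Iterates

variable {E Ω : Type*} [NormedAddCommGroup E] [NormedSpace ℝ E] [SecondCountableTopology E]
  [MeasurableSpace E] [BorelSpace E] {mΩ : MeasurableSpace Ω} {P : Measure Ω}
  [IsProbabilityMeasure P] {ℱ : Filtration ℝ≥0 mΩ} {Y : ℝ≥0 → Ω → E} {μ : ℝ≥0 → Measure E}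
  {c : E → ℝ≥0∞} {t : ℝ≥0} {f : E → ℝ} {n : ℕ} {ε b : ℝ}

theorem opI_eq_comp (hY : HasStationaryIndepIncrements P ℱ Y)
    (hμ : ∀ t, 0 < t → HasLaw (Y t) (μ t) P) (h : ℝ≥0) :
    opI c μ h = transition (P.map (Y h)) ∘ hopfLax c h := by
  funext g
  rcases eq_zero_or_pos h with rfl | hh
  · rw [hY.map_zero, transition_dirac_zero, hopfLax_zero, opI, if_pos rfl]; rfl
  · rw [opI, if_neg hh.ne', (hμ h hh).map_eq]; rfl

theorem opJ_eq_comp (hY : HasStationaryIndepIncrements P ℱ Y)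
    (hμ : ∀ t, 0 < t → HasLaw (Y t) (μ t) P) (h : ℝ≥0) :
    opJ c μ h = hopfLax c h ∘ transition (P.map (Y h)) := by
  funext g
  rcases eq_zero_or_pos h with rfl | hh
  · rw [hY.map_zero, transition_dirac_zero, hopfLax_zero, opJ, if_pos rfl]; rfl
  · rw [opJ, if_neg hh.ne', (hμ h hh).map_eq]; rfl

theorem iterate_opJ_le_value [CompleteSpace E] (h0 : c 0 = 0)
    (hY : HasStationaryIndepIncrements P ℱ Y) (hμ : ∀ t, 0 < t → HasLaw (Y t) (μ t) P)
    (hf : IsUCb f) (h : ℝ≥0) (k : ℕ) (x : E) :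
    ((opJ c μ h)^[k] f x : EReal) ≤ value P ℱ Y c (k * h) f x := by
  rw [opJ_eq_comp hY hμ]
  induction k generalizing f with
  | zero => simpa using (value_zero hY.zero).ge
  | succ k ih =>
    have hJ := (isShiftMonotone_hopfLax (t := h) h0).comp (hY.isShiftMonotone_transition h)
    rw [Function.iterate_succ_apply, Nat.cast_succ, add_one_mul]
    exact (ih (hJ.isUCb hf)).trans (value_hopfLax_transition_le_value_add h0 hY hf x)

theorem value_le_iterate_opI [CompleteSpace E] (hc : ConvexOn ℝ≥0 Set.univ c) (h0 : c 0 = 0)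
    (hY : HasStationaryIndepIncrements P ℱ Y) (hμ : ∀ t, 0 < t → HasLaw (Y t) (μ t) P)
    (hf : IsUCb f) (h : ℝ≥0) (k : ℕ) (x : E) :
    value P ℱ Y c (k * h) f x ≤ ((opI c μ h)^[k] f x : EReal) := by
  rw [opI_eq_comp hY hμ]
  induction k generalizing f with
  | zero => simpa using (value_zero hY.zero).le
  | succ k ih =>
    have hI := (hY.isShiftMonotone_transition h).comp (isShiftMonotone_hopfLax (t := h) h0)
    rw [Function.iterate_succ_apply, Nat.cast_succ, add_one_mul]
    exact (value_add_le_value_transition_hopfLax hc h0 hY hf x).trans (ih (hI.isUCb hf))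

theorem iterate_opI_le_iterate_opJ_add (h0 : c 0 = 0)
    (hY : HasStationaryIndepIncrements P ℱ Y) (hμ : ∀ t, 0 < t → HasLaw (Y t) (μ t) P)
    (hf : IsUCb f) {K : ℝ} (hK : conj c b ≤ K)
    (hmod : ∀ x a, f (x + a) - f x ≤ max ε (b * ‖a‖)) (h : ℝ≥0) (hn : 1 ≤ n) (x : E) :
    (opI c μ h)^[n] f x ≤ (opJ c μ h)^[n] f x + max ε (h * K) := by
  rw [opI_eq_comp hY hμ, opJ_eq_comp hY hμ]
  exact (hY.isShiftMonotone_transition h).iterate_comp_le_iterate_comp_add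
    (isShiftMonotone_hopfLax h0) (fun g hg x => self_le_hopfLax h0 hg.bddAbove_range x) hf
    (fun x => hopfLax_le_add_max h0 hf.bddAbove_range hK (hmod x)) hn x

theorem coe_abs_iterate_opI_sub_iterate_opJ_le [CompleteSpace E]
    (hc : ConvexOn ℝ≥0 Set.univ c) (h0 : c 0 = 0) (hY : HasStationaryIndepIncrements P ℱ Y)
    (hμ : ∀ t, 0 < t → HasLaw (Y t) (μ t) P) (hf : IsUCb f)
    (hmod : ∀ x a, f (x + a) - f x ≤ max ε (b * ‖a‖)) (h : ℝ≥0) (hn : 1 ≤ n) (x : E) :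
    ((|(opI c μ h)^[n] f x - (opJ c μ h)^[n] f x| : ℝ) : EReal) ≤
      max (ε : EReal) ((h : ℝ) * conj c b) := by
  by_cases htop : conj c b = ⊤
  · rcases eq_zero_or_pos h with rfl | hh
    · rw [Function.iterate_fixed (if_pos rfl : opI c μ 0 f = f),
        Function.iterate_fixed (if_pos rfl : opJ c μ 0 f = f)]
      simp
    · rw [htop, EReal.coe_mul_top_of_pos (NNReal.coe_pos.2 hh)]
      exact le_max_of_le_right le_top
  · lift conj c b to ℝ using ⟨htop, conj_ne_bot h0 b⟩ with K hK
    have hle : (opJ c μ h)^[n] f x ≤ (opI c μ h)^[n] f x := EReal.coe_le_coe_iff.1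
      ((iterate_opJ_le_value h0 hY hμ hf h n x).trans (value_le_iterate_opI hc h0 hY hμ hf h n x))
    rw [abs_of_nonneg (sub_nonneg.2 hle), ← EReal.coe_mul, ← EReal.coe_strictMono.monotone.map_max,
      EReal.coe_le_coe_iff, sub_le_iff_le_add']
    exact iterate_opI_le_iterate_opJ_add h0 hY hμ hf hK.ge hmod h hn x

theorem abs_iterate_opI_sub_iterate_opJ_le [CompleteSpace E]
    (hc : ConvexOn ℝ≥0 Set.univ c) (h0 : c 0 = 0) (hY : HasStationaryIndepIncrements P ℱ Y)
    (hμ : ∀ t, 0 < t → HasLaw (Y t) (μ t) P) (hf : IsUCb f) (hε : 0 < ε) (hn : 1 ≤ n)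
    (hle : ((t / ε : ℝ) : EReal) * conj c (oscillation f / invModulus f ε).toReal ≤ (n : ℝ))
    (x : E) : |(opI c μ (t / n))^[n] f x - (opJ c μ (t / n))^[n] f x| ≤ ε := by
  refine EReal.coe_le_coe_iff.1 ((coe_abs_iterate_opI_sub_iterate_opJ_le hc h0 hY hμ hf
    (hf.sub_le_max hε) _ hn x).trans (max_le le_rfl ?_))
  have hn0 : (0 : ℝ) < n := Nat.cast_pos.2 hn
  have hεn : (0 : EReal) ≤ (ε / n : ℝ) := EReal.coe_nonneg.2 (by positivity)
  calc (((t / n : ℝ≥0) : ℝ) : EReal) * conj c (oscillation f / invModulus f ε).toReal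
      = (ε / n : ℝ) * ((t / ε : ℝ) * conj c (oscillation f / invModulus f ε).toReal) := by
        rw [← mul_assoc, ← EReal.coe_mul, NNReal.coe_div, NNReal.coe_natCast,
          div_mul_div_comm, mul_comm ε, mul_div_mul_right _ _ hε.ne']
    _ ≤ (ε / n : ℝ) * (n : ℝ) := mul_le_mul_of_nonneg_left hle hεn
    _ = ε := by rw [← EReal.coe_mul, div_mul_cancel₀ _ hn0.ne']

theorem coe_abs_iterate_opI_sub_iterate_opJ_le_lipSeminorm [CompleteSpace E]
    (hc : ConvexOn ℝ≥0 Set.univ c) (h0 : c 0 = 0) (hY : HasStationaryIndepIncrements P ℱ Y)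
    (hμ : ∀ t, 0 < t → HasLaw (Y t) (μ t) P) (hf : IsUCb f) (hL : lipSeminorm f ≠ ⊤)
    (h : ℝ≥0) (hn : 1 ≤ n) (x : E) :
    ((|(opI c μ h)^[n] f x - (opJ c μ h)^[n] f x| : ℝ) : EReal) ≤
      (h : ℝ) * conj c (lipSeminorm f).toReal := by
  have hgap := coe_abs_iterate_opI_sub_iterate_opJ_le (ε := 0) hc h0 hY hμ hf
    (fun x a => (sub_le_lipSeminorm_mul hL x a).trans (le_max_right _ _)) h hn x
  have hconj : 0 ≤ ((h : ℝ) : EReal) * conj c (lipSeminorm f).toReal :=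
    mul_nonneg (EReal.coe_nonneg.2 h.coe_nonneg) (conj_nonneg h0 _)
  rwa [EReal.coe_zero, max_eq_right hconj] at hgap

end Iterates

end LevyControl

open LevyControl in
theorem mainTheorem1_general {E : Type*} [NormedAddCommGroup E] [NormedSpace ℝ E] [CompleteSpace E]
    [TopologicalSpace.SeparableSpace E] [MeasurableSpace E] [BorelSpace E]
    (c : E → ℝ≥0∞) (hc : ConvexOn ℝ≥0 Set.univ c) (h0 : c 0 = 0)
    {Ω : Type*} {mΩ : MeasurableSpace Ω} (P : Measure Ω) [IsProbabilityMeasure P]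
    (ℱ : Filtration ℝ≥0 mΩ) (Y : ℝ≥0 → Ω → E) (hY : HasStationaryIndepIncrements P ℱ Y)
    (μ : ℝ≥0 → Measure E) (hμ : ∀ t, 0 < t → HasLaw (Y t) (μ t) P)
    (t : ℝ≥0) (f : E → ℝ) (hf : IsUCb f) :
    (∀ n : ℕ, 1 ≤ n → ∀ x : E,
      (((opJ c μ (t / n))^[n] f x : ℝ) : EReal) ≤ value P ℱ Y c t f x ∧
      value P ℱ Y c t f x ≤ (((opI c μ (t / n))^[n] f x : ℝ) : EReal)) ∧
    (∀ ε : ℝ, 0 < ε → ∀ n : ℕ, 1 ≤ n →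
      (((t : ℝ) / ε : ℝ) : EReal) *
          conj c (LevyControl.oscillation f / invModulus f ε).toReal ≤ ((n : ℝ) : EReal) →
      ∀ x : E, |(opI c μ (t / n))^[n] f x - (opJ c μ (t / n))^[n] f x| ≤ ε) ∧
    (Tendsto (fun a => c a / ‖a‖ₑ) (Bornology.cobounded E) (𝓝 ⊤) → ∀ x : E,
      IsLUB ((fun n : ℕ => (((opJ c μ (t / n))^[n] f x : ℝ) : EReal)) '' Set.Ici 1)
        (value P ℱ Y c t f x) ∧
      IsGLB ((fun n : ℕ => (((opI c μ (t / n))^[n] f x : ℝ) : EReal)) '' Set.Ici 1)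
        (value P ℱ Y c t f x)) ∧
    (lipSeminorm f < ⊤ → ∀ n : ℕ, 1 ≤ n → ∀ x : E,
      ((|(opI c μ (t / n))^[n] f x - (opJ c μ (t / n))^[n] f x| : ℝ) : EReal) ≤
        (((t : ℝ) / n : ℝ) : EReal) * conj c (lipSeminorm f).toReal) := by
  have : SecondCountableTopology E := UniformSpace.secondCountable_of_separable E
  have hbounds (n : ℕ) (hn : 1 ≤ n) (x : E) :
      (((opJ c μ (t / n))^[n] f x : ℝ) : EReal) ≤ value P ℱ Y c t f x ∧
      value P ℱ Y c t f x ≤ (((opI c μ (t / n))^[n] f x : ℝ) : EReal) := by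
    have hJ := iterate_opJ_le_value h0 hY hμ hf (t / n) n x
    have hI := value_le_iterate_opI hc h0 hY hμ hf (t / n) n x
    rw [mul_div_cancel₀ t (Nat.cast_ne_zero.2 (Nat.one_le_iff_ne_zero.1 hn))] at hJ hI
    exact ⟨hJ, hI⟩
  refine ⟨hbounds, fun ε hε n hn hle x =>
    abs_iterate_opI_sub_iterate_opJ_le hc h0 hY hμ hf hε hn hle x, fun hsup x => ?_,
    fun hL n hn x => ?_⟩
  · refine isLUB_and_isGLB_of_squeeze (fun n hn => (hbounds n hn x).1)
      (fun n hn => (hbounds n hn x).2) fun ε hε => ?_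
    obtain ⟨n, hn, hle⟩ := exists_nat_mul_conj_le h0 (conj_ne_top hsup _) (t / ε)
    exact ⟨n, hn, abs_iterate_opI_sub_iterate_opJ_le hc h0 hY hμ hf hε hn hle x⟩
  · simpa using coe_abs_iterate_opI_sub_iterate_opJ_le_lipSeminorm hc h0 hY hμ hf
      hL.ne (t / n) hn x

theorem mainTheorem1 {E : Type*} [NormedAddCommGroup E] [NormedSpace ℝ E] [CompleteSpace E]
    [TopologicalSpace.SeparableSpace E] [MeasurableSpace E] [BorelSpace E]
    (c : E → ℝ≥0∞) (hc : LevyControl.IsCost c)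
    {Ω : Type*} {mΩ : MeasurableSpace Ω} (P : Measure Ω) [IsProbabilityMeasure P]
    (ℱ : Filtration ℝ≥0 mΩ) (Y : ℝ≥0 → Ω → E) (hY : LevyControl.IsLevyProcess P ℱ Y)
    (μ : ℝ≥0 → Measure E) (hμ : ∀ t, 0 < t → HasLaw (Y t) (μ t) P)
    (t : ℝ≥0) (f : E → ℝ) (hf : LevyControl.IsUCb f) :
    -- (a), the bounds from below and above
    (∀ n : ℕ, 1 ≤ n → ∀ x : E,
      (((LevyControl.opJ c μ (t / n))^[n] f x : ℝ) : EReal) ≤ LevyControl.value P ℱ Y c t f x ∧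
      LevyControl.value P ℱ Y c t f x ≤ (((LevyControl.opI c μ (t / n))^[n] f x : ℝ) : EReal)) ∧
    -- (a), the guarantee
    (∀ ε : ℝ, 0 < ε → ∀ n : ℕ, 1 ≤ n →
      (((t : ℝ) / ε : ℝ) : EReal) *
          LevyControl.conj c
            (LevyControl.oscillation f / LevyControl.invModulus f ε).toReal ≤ ((n : ℝ) : EReal) →
      ∀ x : E, |(LevyControl.opI c μ (t / n))^[n] f x - (LevyControl.opJ c μ (t / n))^[n] f x|
        ≤ ε) ∧
    -- (a), the value function as supremum and infimum
    (∀ x : E,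
      IsLUB ((fun n : ℕ => (((LevyControl.opJ c μ (t / n))^[n] f x : ℝ) : EReal)) '' Set.Ici 1)
        (LevyControl.value P ℱ Y c t f x) ∧
      IsGLB ((fun n : ℕ => (((LevyControl.opI c μ (t / n))^[n] f x : ℝ) : EReal)) '' Set.Ici 1)
        (LevyControl.value P ℱ Y c t f x)) ∧
    -- (b), the rate for Lipschitz functions
    (LevyControl.lipSeminorm f < ⊤ → ∀ n : ℕ, 1 ≤ n → ∀ x : E,
      ((|(LevyControl.opI c μ (t / n))^[n] f x - (LevyControl.opJ c μ (t / n))^[n] f x| : ℝ) :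
          EReal)
        ≤ (((t : ℝ) / n : ℝ) : EReal) *
          LevyControl.conj c (LevyControl.lipSeminorm f).toReal) := by
  obtain ⟨hbounds, hguarantee, hsupinf, hlip⟩ := mainTheorem1_general c hc.convex hc.zero P ℱ Y
    hY.hasStationaryIndepIncrements μ hμ t f hf
  exact ⟨hbounds, hguarantee, hsupinf hc.superlinear, hlip⟩
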